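/- Let $n\ge 1$ and let $M=\langle a_1,\dots,a_n\rangle$ be the Chinese monoid of rank $n$, i.e. the monoid with generators $a_1,\dots,a_n$ and defining relations $$a_ja_ia_k=a_ja_ka_i=a_ka_ja_i\qquad\text{for } 1\le i\le k\le j\le n.$$ Then $M$ satisfies the semigroup identity $xy^2x\,xy\,xy^2x=xy^2x\,yx\,xy^2x$; that is, for all $x,y\in M$, $$xy^2x\cdot xy\cdot xy^2x=xy^2x\cdot yx\cdot xy^2x .$$ -/

import Mathlib

/-- The defining relations of the Chinese monoid of rank `n`, on words in the generators
`a_i` (`i : Fin n`): `a_j a_i a_k = a_j a_k a_i` and `a_j a_k a_i = a_k a_j a_i`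
for all `i ≤ k ≤ j`. -/
inductive ChineseRel (n : ℕ) : FreeMonoid (Fin n) → FreeMonoid (Fin n) → Prop
  | left (i k j : Fin n) (hik : i ≤ k) (hkj : k ≤ j) :
      ChineseRel n (FreeMonoid.of j * FreeMonoid.of i * FreeMonoid.of k)
        (FreeMonoid.of j * FreeMonoid.of k * FreeMonoid.of i)
  | right (i k j : Fin n) (hik : i ≤ k) (hkj : k ≤ j) :
      ChineseRel n (FreeMonoid.of j * FreeMonoid.of k * FreeMonoid.of i)
        (FreeMonoid.of k * FreeMonoid.of j * FreeMonoid.of i)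

/-- The Chinese monoid of rank `n`: the monoid presented by generators `a_i` (`i : Fin n`)
and the relations `a_j a_i a_k = a_j a_k a_i = a_k a_j a_i` for `i ≤ k ≤ j`. -/
abbrev ChineseMonoid (n : ℕ) : Type := PresentedMonoid (ChineseRel n)

/-! The identity is Adjan's identity for the bicyclic monoid, and `M` embeds in a product of
bicyclic actions. For thresholds `r ≤ s`, small letters act on `ℕ` as successor and large ones as
truncated predecessor. Every element then acts as some `t ↦ max (t + d) c`, and for such maps the
identity is a computation with maxima (`IsTropicalAffine.adjan`).

The main work is that these actions jointly separate elements (`ext_action`). Every element is a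
product, over increasing `i`, of blocks `∏_{j<i} (a_i a_j)^(e j) · a_i^c`, and the values of the
actions at `0` determine all the exponents. -/

namespace ChineseMonoid

/-! ### The bicyclic action on `ℕ` -/

/-- The letters `l < r` act on `ℕ` as the successor, the letters `l ≥ s` as the predecessor,
and the remaining ones trivially. -/
def letterAction (r s l : ℕ) : Function.End ℕ :=
  if l < r then fun t => t + 1 else if s ≤ l then fun t => t - 1 else fun t => t

theorem end_mul_apply (f g : Function.End ℕ) (t : ℕ) : (f * g) t = f (g t) := rfl

theorem end_one_apply (t : ℕ) : (1 : Function.End ℕ) t = t := rfl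

theorem letterAction_of_lt {r s l : ℕ} (h : l < r) (t : ℕ) : letterAction r s l t = t + 1 := by
  simp [letterAction, h]

theorem letterAction_of_le {r s l : ℕ} (hrs : r ≤ s) (h : s ≤ l) (t : ℕ) :
    letterAction r s l t = t - 1 := by
  simp [letterAction, h, not_lt.2 (hrs.trans h)]

theorem letterAction_of_mid {r s l : ℕ} (h : r ≤ l) (h' : l < s) (t : ℕ) :
    letterAction r s l t = t := by
  simp [letterAction, not_lt.2 h, not_le.2 h']

theorem letterAction_cases {r s : ℕ} (hrs : r ≤ s) (l : ℕ) :
    (l < r ∧ ∀ t, letterAction r s l t = t + 1) ∨ (s ≤ l ∧ ∀ t, letterAction r s l t = t - 1) ∨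
      (r ≤ l ∧ l < s ∧ ∀ t, letterAction r s l t = t) := by
  rcases lt_or_ge l r with h | h
  · exact Or.inl ⟨h, letterAction_of_lt h⟩
  · rcases lt_or_ge l s with h' | h'
    · exact Or.inr (Or.inr ⟨h, h', letterAction_of_mid h h'⟩)
    · exact Or.inr (Or.inl ⟨h', letterAction_of_le hrs h'⟩)

/-- The action of the Chinese monoid on `ℕ` through the bicyclic monoid. -/
def action (n : ℕ) {r s : ℕ} (hrs : r ≤ s) : ChineseMonoid n →* Function.End ℕ :=
  PresentedMonoid.lift (fun l : Fin n => letterAction r s l) <| by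
    rintro _ _ (⟨i, k, j, hik, hkj⟩ | ⟨i, k, j, hik, hkj⟩) <;>
    · simp only [map_mul, FreeMonoid.lift_eval_of]
      funext t
      have hik : (i : ℕ) ≤ k := hik
      have hkj : (k : ℕ) ≤ j := hkj
      simp only [end_mul_apply]
      rcases letterAction_cases hrs i with ⟨h₁, e₁⟩ | ⟨h₁, e₁⟩ | ⟨h₁, h₁', e₁⟩ <;>
      rcases letterAction_cases hrs j with ⟨h₂, e₂⟩ | ⟨h₂, e₂⟩ | ⟨h₂, h₂', e₂⟩ <;>
      rcases letterAction_cases hrs k with ⟨h₃, e₃⟩ | ⟨h₃, e₃⟩ | ⟨h₃, h₃', e₃⟩ <;>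
      simp only [e₁, e₂, e₃] <;> omega

/-! ### Generators and relations -/

/-- The generator with index `l`, with value `1` out of range. -/
def gen (n l : ℕ) : ChineseMonoid n :=
  if h : l < n then PresentedMonoid.of _ ⟨l, h⟩ else 1

variable {n : ℕ}

theorem action_gen {r s l : ℕ} (hrs : r ≤ s) (hl : l < n) :
    action n hrs (gen n l) = letterAction r s l := by
  simp only [gen, hl, dif_pos]
  exact PresentedMonoid.lift_of _ _

theorem mk_eq_of_rel {v w : FreeMonoid (Fin n)} (h : ChineseRel n v w) :
    PresentedMonoid.mk (ChineseRel n) v = PresentedMonoid.mk (ChineseRel n) w :=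
  (Con.eq _).2 (ConGen.Rel.of _ _ h)

theorem gen_swap {i k j : ℕ} (hik : i ≤ k) (hkj : k ≤ j) (hj : j < n) :
    gen n j * gen n i * gen n k = gen n j * gen n k * gen n i := by
  simp only [gen, hj, hkj.trans_lt hj, (hik.trans hkj).trans_lt hj, dif_pos]
  exact mk_eq_of_rel (ChineseRel.left ⟨i, _⟩ ⟨k, _⟩ ⟨j, _⟩ hik hkj)

theorem gen_commute {i k j : ℕ} (hik : i ≤ k) (hkj : k ≤ j) (hj : j < n) :
    Commute (gen n j * gen n i) (gen n k) := by
  unfold Commute SemiconjBy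
  rw [gen_swap hik hkj hj, ← mul_assoc]
  simp only [gen, hj, hkj.trans_lt hj, (hik.trans hkj).trans_lt hj, dif_pos]
  exact mk_eq_of_rel (ChineseRel.right ⟨i, _⟩ ⟨k, _⟩ ⟨j, _⟩ hik hkj)

theorem pair_commute {i j l : ℕ} (hj : j ≤ i) (hl : l ≤ i) (hi : i < n) :
    Commute (gen n i * gen n j) (gen n i * gen n l) := by
  rcases le_total j l with h | h
  · exact (gen_commute hj le_rfl hi).mul_right (gen_commute h hl hi)
  · exact ((gen_commute hl le_rfl hi).mul_right (gen_commute h hj hi)).symm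

/-! ### Normal forms -/

/-- The product of `(a_i a_j) ^ (e j)` over `j < m`, in increasing order of `j`. -/
def row (n i : ℕ) (e : ℕ → ℕ) : ℕ → ChineseMonoid n
  | 0 => 1
  | m + 1 => row n i e m * (gen n i * gen n m) ^ e m

theorem row_congr {i m : ℕ} {e e' : ℕ → ℕ} (h : ∀ j < m, e j = e' j) :
    row n i e m = row n i e' m := by
  induction m with
  | zero => rfl
  | succ m ih => rw [row, row, ih fun j hj => h j (by omega), h m (by omega)]

theorem row_commute_gen {i m l : ℕ} (e : ℕ → ℕ) (hml : m ≤ l + 1) (hl : l ≤ i) (hi : i < n) :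
    Commute (row n i e m) (gen n l) := by
  induction m with
  | zero => exact Commute.one_left _
  | succ m ih =>
    exact (ih (by omega)).mul_left ((gen_commute (by omega) hl hi).pow_left _)

theorem row_mul_pair {i m l : ℕ} (e : ℕ → ℕ) (hlm : l < m) (hm : m ≤ i) (hi : i < n) :
    row n i e m * (gen n i * gen n l) = row n i (Function.update e l (e l + 1)) m := by
  induction m with
  | zero => omega
  | succ m ih =>
    rw [row, row]
    rcases eq_or_ne l m with rfl | h
    · rw [Function.update_self, pow_succ, mul_assoc]
      congr 1
      exact row_congr fun j hj => (Function.update_of_ne hj.ne _ _).symm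
    · rw [mul_assoc, ((pair_commute (by omega) (by omega) hi).pow_left _).eq, ← mul_assoc,
        ih (by omega) (by omega), Function.update_of_ne h.symm]

/-- If no pair `a_i a_k` with `k > l` occurs, `a_l` commutes with the row. Otherwise take the
largest such `k`: since `a_i a_k a_l = a_i a_l a_k`, one pair `a_i a_k` turns into `a_i a_l`, and
the freed `a_k` commutes out to the left. -/
theorem row_mul_gen {i m l : ℕ} (e : ℕ → ℕ) (hl : l < i) (hm : m ≤ i) (hi : i < n) :
    ∃ l' < i, ∃ e', row n i e m * gen n l = gen n l' * row n i e' m := by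
  induction m with
  | zero => exact ⟨l, hl, e, by simp [row]⟩
  | succ m ih =>
    rcases le_or_gt (m + 1) (l + 1) with h | h
    · exact ⟨l, hl, e, (row_commute_gen e h hl.le hi).eq⟩
    · rcases Nat.eq_zero_or_pos (e m) with h0 | h0
      · obtain ⟨l', hl', e', he⟩ := ih (by omega)
        refine ⟨l', hl', Function.update e' m 0, ?_⟩
        simp only [row, h0, Function.update_self, pow_zero, mul_one, he]
        congr 1
        exact row_congr fun j hj => (Function.update_of_ne hj.ne _ _).symm
      · obtain ⟨c, hc⟩ := Nat.exists_eq_succ_of_ne_zero h0.ne'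
        let e₁ := Function.update e m c
        refine ⟨m, by omega, Function.update e₁ l (e₁ l + 1), ?_⟩
        rw [← row_mul_pair e₁ (by omega) hm hi,
          ← mul_assoc (gen n m), ← (row_commute_gen e₁ le_rfl (by omega) hi).eq, row, row]
        have hr : row n i e₁ m = row n i e m :=
          row_congr fun j hj => Function.update_of_ne hj.ne _ _
        have hm' : e₁ m = c := Function.update_self ..
        rw [hr, hm', hc, pow_succ]
        simp only [mul_assoc]
        congr 2
        rw [← (gen_commute (n := n) (i := l) (k := m) (j := i) (by omega) (by omega) hi).eq,
          gen_swap (by omega) (by omega) hi, mul_assoc]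

/-- Normal forms in the generators with index less than `m`. -/
def IsNormal (n : ℕ) : ℕ → ChineseMonoid n → Prop
  | 0, x => x = 1
  | m + 1, x => ∃ y e c, IsNormal n m y ∧ x = y * (row n m e m * gen n m ^ c)

theorem isNormal_one (m : ℕ) : IsNormal n m 1 := by
  induction m with
  | zero => rfl
  | succ m ih =>
    refine ⟨1, 0, 0, ih, ?_⟩
    have h : ∀ k, row n m 0 k = 1 := fun k => by
      induction k with
      | zero => rfl
      | succ k ih => simp [row, ih]
    simp [h]

theorem IsNormal.mul_gen {m l : ℕ} {x : ChineseMonoid n} (hx : IsNormal n m x) (hl : l < m)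
    (hm : m ≤ n) : IsNormal n m (x * gen n l) := by
  induction m generalizing x l with
  | zero => omega
  | succ m ih =>
    obtain ⟨y, e, c, hy, rfl⟩ := hx
    rcases Nat.lt_succ_iff_lt_or_eq.1 hl with h | rfl
    -- With no trailing `a_m`, a smaller letter leaves the block on the left and is absorbed by `y`.
    -- Otherwise `a_l` pairs with one `a_m`, and the pair commutes past the other copies into the
    -- row.
    · cases c with
      | zero =>
        obtain ⟨l', hl', e', he⟩ := row_mul_gen e h le_rfl hm
        refine ⟨y * gen n l', e', 0, ih hy hl' (by omega), ?_⟩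
        rw [pow_zero, mul_one, mul_one, mul_assoc, he, mul_assoc]
      | succ c =>
        refine ⟨y, Function.update e l (e l + 1), c, hy, ?_⟩
        rw [← row_mul_pair e h le_rfl hm, pow_succ]
        simp only [mul_assoc]
        congr 2
        rw [← mul_assoc (gen n m) (gen n l),
          ((gen_commute h.le le_rfl hm).pow_right c).eq]
    · exact ⟨y, e, c + 1, hy, by rw [pow_succ]; simp only [mul_assoc]⟩

theorem isNormal (x : ChineseMonoid n) : IsNormal n n x := by
  obtain ⟨w, rfl⟩ := PresentedMonoid.surjective_mk x
  suffices h : ∀ (w : FreeMonoid (Fin n)) (y : ChineseMonoid n), IsNormal n n y →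
      IsNormal n n (y * PresentedMonoid.mk _ w) by
    simpa using h w 1 (isNormal_one n)
  intro w
  induction w using FreeMonoid.inductionOn' with
  | one => intro y hy; simpa using hy
  | of_mul l w ih =>
    intro y hy
    rw [map_mul, ← mul_assoc]
    refine ih _ ?_
    have := hy.mul_gen l.2 le_rfl
    simp only [gen, l.2, dif_pos] at this
    exact this

/-! ### Separation of normal forms -/

theorem action_pair_apply {r s i j : ℕ} (hrs : r ≤ s) (hi : i < n) (hj : j < n) (t : ℕ) :
    action n hrs (gen n i * gen n j) t = letterAction r s i (letterAction r s j t) := by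
  rw [map_mul, action_gen hrs hi, action_gen hrs hj]
  rfl

theorem action_mul_apply {r s : ℕ} (hrs : r ≤ s) (x y : ChineseMonoid n) (t : ℕ) :
    action n hrs (x * y) t = action n hrs x (action n hrs y t) := by
  rw [map_mul]
  rfl

theorem action_pow_apply_of_forall {r s d : ℕ} (hrs : r ≤ s) {x : ChineseMonoid n}
    (h : ∀ t, action n hrs x t = t + d) (c t : ℕ) : action n hrs (x ^ c) t = t + c * d := by
  induction c generalizing t with
  | zero => simp [end_one_apply]
  | succ c ih => rw [pow_succ, action_mul_apply, h, ih]; ring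

theorem action_pow_apply_zero {r s : ℕ} (hrs : r ≤ s) {x : ChineseMonoid n}
    (h : action n hrs x 0 = 0) (c : ℕ) : action n hrs (x ^ c) 0 = 0 := by
  induction c with
  | zero => simp [end_one_apply]
  | succ c ih => rw [pow_succ, action_mul_apply, h, ih]

/-- Here `a_i` is the truncated predecessor, which undoes the at most one successor step of its
partner. Thus thresholds `s ≤ i` do not see the block of `a_i`. -/
theorem action_row_apply_zero {r s i m : ℕ} (hrs : r ≤ s) (hs : s ≤ i) (hi : i < n) (hm : m ≤ i)
    (e : ℕ → ℕ) (c : ℕ) : action n hrs (row n i e m * gen n i ^ c) 0 = 0 := by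
  have h₁ : action n hrs (gen n i ^ c) 0 = 0 :=
    action_pow_apply_zero hrs (by rw [action_gen hrs hi, letterAction_of_le hrs hs]) c
  rw [action_mul_apply, h₁]
  induction m with
  | zero => simp [row, end_one_apply]
  | succ m ih =>
    rw [row, action_mul_apply, action_pow_apply_zero hrs, ih (by omega)]
    rw [action_pair_apply hrs hi (by omega), letterAction_of_le hrs hs]
    rcases letterAction_cases hrs m with ⟨-, h⟩ | ⟨-, h⟩ | ⟨-, -, h⟩ <;> rw [h]

/-- With `s = i + 1` and `r ≤ i` the letter `a_i` acts trivially, so only the partners `a_j` with `j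
< r` count. Varying `r` recovers each `e j` as a difference of partial sums. -/
theorem action_row_apply {r i m : ℕ} (hr : r ≤ i) (hi : i < n) (hm : m ≤ i) (e : ℕ → ℕ) (t : ℕ) :
    action n (hr.trans i.le_succ) (row n i e m) t = t + ∑ j ∈ Finset.range (min m r), e j := by
  induction m generalizing t with
  | zero => simp [row, end_one_apply]
  | succ m ih =>
    rw [row, action_mul_apply]
    rcases lt_or_ge m r with h | h
    · rw [action_pow_apply_of_forall (d := 1), ih (by omega), min_eq_left (by omega),
        min_eq_left (by omega), Finset.sum_range_succ]
      · ring
      · intro t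
        rw [action_pair_apply _ hi (by omega), letterAction_of_mid hr (by omega),
          letterAction_of_lt h]
    · rw [action_pow_apply_of_forall (d := 0), ih (by omega), min_eq_right (by omega),
        min_eq_right (by omega)]
      · ring
      · intro t
        rw [action_pair_apply _ hi (by omega), letterAction_of_mid hr (by omega),
          letterAction_of_mid h (by omega), add_zero]

theorem action_full_row_apply {i m : ℕ} (hi : i < n) (hm : m ≤ i) (e : ℕ → ℕ) (t : ℕ) :
    action n (le_refl (i + 1)) (row n i e m) t = t + 2 * ∑ j ∈ Finset.range m, e j := by
  induction m generalizing t with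
  | zero => simp [row, end_one_apply]
  | succ m ih =>
    rw [row, action_mul_apply, action_pow_apply_of_forall (d := 2), ih (by omega),
      Finset.sum_range_succ]
    · ring
    · intro t
      rw [action_pair_apply _ hi (by omega), letterAction_of_lt (by omega),
        letterAction_of_lt (by omega)]

theorem row_mul_pow_injective {i c c' : ℕ} {e e' : ℕ → ℕ} (hi : i < n)
    (h : ∀ r (hr : r ≤ i + 1), action n hr (row n i e i * gen n i ^ c) 0 =
      action n hr (row n i e' i * gen n i ^ c') 0) :
    row n i e i * gen n i ^ c = row n i e' i * gen n i ^ c' := by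
  have hsum : ∀ r ≤ i, ∑ j ∈ Finset.range r, e j = ∑ j ∈ Finset.range r, e' j := by
    intro r hr
    have h₁ := h r (hr.trans i.le_succ)
    have h₂ : ∀ t, action n (hr.trans i.le_succ) (gen n i) t = t + 0 := fun t => by
      rw [action_gen _ hi, letterAction_of_mid hr (by omega), add_zero]
    rw [action_mul_apply, action_mul_apply, action_row_apply hr hi le_rfl,
      action_row_apply hr hi le_rfl, action_pow_apply_of_forall _ h₂,
      action_pow_apply_of_forall _ h₂, min_eq_right hr] at h₁
    omega
  have he : ∀ j < i, e j = e' j := by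
    intro j hj
    have h₁ := hsum (j + 1) hj
    rw [Finset.sum_range_succ, Finset.sum_range_succ, hsum j hj.le] at h₁
    omega
  -- At `r = s = i + 1` every letter of the block is a successor, so the value at `0` is its length
  -- `2 * ∑ e j + c`.
  have hc : c = c' := by
    have h₁ := h (i + 1) le_rfl
    have h₂ : ∀ t, action n (le_refl (i + 1)) (gen n i) t = t + 1 := fun t => by
      rw [action_gen _ hi, letterAction_of_lt (by omega)]
    rw [action_mul_apply, action_mul_apply, action_full_row_apply hi le_rfl,
      action_full_row_apply hi le_rfl, action_pow_apply_of_forall _ h₂,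
      action_pow_apply_of_forall _ h₂, hsum i le_rfl] at h₁
    omega
  rw [row_congr he, hc]

/-- Only predecessors fail to be injective, and they need an index at least `s ≥ m`. -/
theorem IsNormal.action_injective {m r s : ℕ} (hrs : r ≤ s) {x : ChineseMonoid n}
    (hx : IsNormal n m x) (hms : m ≤ s) (hm : m ≤ n) :
    Function.Injective (action n hrs x) := by
  have hgen : ∀ l < m, Function.Injective (action n hrs (gen n l)) := by
    intro l hl a b hab
    rw [action_gen hrs (by omega)] at hab
    rcases letterAction_cases hrs l with ⟨-, h⟩ | ⟨h, -⟩ | ⟨-, -, h⟩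
    · rw [h, h] at hab
      omega
    · omega
    · rwa [h, h] at hab
  have hmul : ∀ y z : ChineseMonoid n, Function.Injective (action n hrs y) →
      Function.Injective (action n hrs z) → Function.Injective (action n hrs (y * z)) := by
    intro y z hy hz
    rw [map_mul]
    exact hy.comp hz
  have hone : Function.Injective (action n hrs 1) := by
    rw [map_one]
    exact Function.injective_id
  have hpow : ∀ (y : ChineseMonoid n) (c : ℕ), Function.Injective (action n hrs y) →
      Function.Injective (action n hrs (y ^ c)) := by
    intro y c hy
    induction c with
    | zero => rwa [pow_zero]
    | succ c ih => rw [pow_succ]; exact hmul _ _ ih hy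
  induction m generalizing x with
  | zero => rw [show x = 1 from hx]; exact hone
  | succ m ih =>
    obtain ⟨y, e, c, hy, rfl⟩ := hx
    refine hmul _ _ (ih hy (by omega) (by omega) fun l hl => hgen l (by omega))
      (hmul _ _ ?_ (hpow _ _ (hgen m (by omega))))
    have hrow : ∀ k ≤ m, Function.Injective (action n hrs (row n m e k)) := by
      intro k hk
      induction k with
      | zero => exact hone
      | succ k ihk =>
        exact hmul _ _ (ihk (by omega))
          (hpow _ _ (hmul _ _ (hgen m (by omega)) (hgen k (by omega))))
    exact hrow m le_rfl

/-- Thresholds `s ≤ m` hide the top block, so induction identifies the lower parts. At `s = m + 1`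
the lower part acts injectively and can be cancelled, leaving the top blocks to compare. -/
theorem IsNormal.ext {m : ℕ} {x x' : ChineseMonoid n} (hx : IsNormal n m x)
    (hx' : IsNormal n m x') (hm : m ≤ n)
    (h : ∀ r s (hrs : r ≤ s), s ≤ m → action n hrs x 0 = action n hrs x' 0) : x = x' := by
  induction m generalizing x x' with
  | zero => exact hx.trans hx'.symm
  | succ m ih =>
    obtain ⟨y, e, c, hy, rfl⟩ := hx
    obtain ⟨y', e', c', hy', rfl⟩ := hx'
    obtain rfl : y = y' := by
      refine ih hy hy' (by omega) fun r s hrs hs => ?_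
      have h₁ := h r s hrs (by omega)
      rwa [action_mul_apply hrs y, action_mul_apply hrs y', action_row_apply_zero hrs hs hm le_rfl,
        action_row_apply_zero hrs hs hm le_rfl] at h₁
    congr 1
    refine row_mul_pow_injective hm fun r hr => ?_
    have h₁ := h r (m + 1) hr le_rfl
    rw [action_mul_apply hr y, action_mul_apply hr y] at h₁
    exact hy.action_injective hr (by omega) (by omega) h₁

/-- The actions of the Chinese monoid on `ℕ` separate its elements. -/
theorem ext_action {x x' : ChineseMonoid n}
    (h : ∀ r s (hrs : r ≤ s), action n hrs x = action n hrs x') : x = x' :=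
  (isNormal x).ext (isNormal x') le_rfl fun r s hrs _ => by rw [h r s hrs]

/-! ### Tropical affine maps -/

/-- Maps of the form `t ↦ max (t + d) c`. -/
def IsTropicalAffine (d : ℤ) (f : Function.End ℕ) : Prop :=
  ∃ c : ℤ, ∀ t, (f t : ℤ) = max (t + d) c

theorem IsTropicalAffine.mul {d d' : ℤ} {f g : Function.End ℕ} (hf : IsTropicalAffine d f)
    (hg : IsTropicalAffine d' g) : IsTropicalAffine (d + d') (f * g) := by
  obtain ⟨c, hc⟩ := hf
  obtain ⟨c', hc'⟩ := hg
  refine ⟨max (c' + d) c, fun t => ?_⟩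
  rw [end_mul_apply, hc, hc']
  omega

theorem isTropicalAffine_one : IsTropicalAffine 0 1 :=
  ⟨0, fun t => by simp [end_one_apply]⟩

theorem isTropicalAffine_letterAction {r s : ℕ} (hrs : r ≤ s) (l : ℕ) :
    ∃ d, IsTropicalAffine d (letterAction r s l) := by
  rcases letterAction_cases hrs l with ⟨-, h⟩ | ⟨-, h⟩ | ⟨-, -, h⟩
  · exact ⟨1, 0, fun t => by rw [h]; omega⟩
  · exact ⟨-1, 0, fun t => by rw [h]; omega⟩
  · exact ⟨0, 0, fun t => by rw [h]; omega⟩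

theorem isTropicalAffine_action {r s : ℕ} (hrs : r ≤ s) (x : ChineseMonoid n) :
    ∃ d, IsTropicalAffine d (action n hrs x) := by
  obtain ⟨w, rfl⟩ := PresentedMonoid.surjective_mk x
  induction w using FreeMonoid.inductionOn' with
  | one => exact ⟨0, by simpa using isTropicalAffine_one⟩
  | of_mul l w ih =>
    obtain ⟨d, hd⟩ := ih
    obtain ⟨d', hd'⟩ := isTropicalAffine_letterAction hrs l
    rw [map_mul, map_mul]
    exact ⟨_, IsTropicalAffine.mul hd' hd⟩

/-- The two composites have constants differing only in the term of the middle factor, `a + 2d`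
against `b + 2d`. Neither matters: `a + 2d ≤ max a (a + 3d)` and `b + 2d ≤ max (b + d) (b + 4d)`,
and these bounds occur on both sides. -/
theorem IsTropicalAffine.mul_swap {d : ℤ} {u v : Function.End ℕ} (hu : IsTropicalAffine d u)
    (hv : IsTropicalAffine d v) : u * v * u * (u * v) = u * v * v * (u * v) := by
  obtain ⟨a, ha⟩ := hu
  obtain ⟨b, hb⟩ := hv
  funext t
  apply Int.ofNat_injective
  simp only [Int.ofNat_eq_natCast, end_mul_apply, ha, hb]
  omega

theorem IsTropicalAffine.adjan {d d' : ℤ} {f g : Function.End ℕ} (hf : IsTropicalAffine d f)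
    (hg : IsTropicalAffine d' g) :
    (f * g ^ 2 * f) * (f * g) * (f * g ^ 2 * f) = (f * g ^ 2 * f) * (g * f) * (f * g ^ 2 * f) := by
  -- Take `u = f * g` and `v = g * f`, which share the shift `d + d'`; then `f * g ^ 2 * f = u * v`.
  have h := IsTropicalAffine.mul_swap (hf.mul hg) (add_comm d' d ▸ hg.mul hf)
  simpa only [pow_two, mul_assoc] using h

end ChineseMonoid

theorem corollary3p3p4 (n : ℕ) (x y : ChineseMonoid n) :
    (x * y ^ 2 * x) * (x * y) * (x * y ^ 2 * x) =
      (x * y ^ 2 * x) * (y * x) * (x * y ^ 2 * x) := by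
  refine ChineseMonoid.ext_action fun r s hrs => ?_
  obtain ⟨d, hx⟩ := ChineseMonoid.isTropicalAffine_action hrs x
  obtain ⟨d', hy⟩ := ChineseMonoid.isTropicalAffine_action hrs y
  simpa only [map_mul, map_pow] using hx.adjan hy
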